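/- Let $\mathbb{H}=\mathbb{R}^3$ be the Heisenberg group with the group law $(x,y,t)\circ(x',y',t')=(x+x',\,y+y',\,t+t'+2(x'y-xy'))$. Let $V_1\cong\mathbb{R}^2$ be the first layer of its Lie algebra, with the Euclidean inner product $\langle\cdot,\cdot\rangle$; put $\exp(a,b)=(a,b,0)$ for $(a,b)\in V_1$, $\xi_1(x,y,t)=(x,y)$, and for $g\in\mathbb{H}$ let $H_g=\{g\circ\exp w : w\in V_1\}$ be the horizontal plane at $g$. For a set-valued map $T:\mathbb{H}\rightrightarrows V_1$ let $\mathrm{dom}(T)=\{g : T(g)\ne\emptyset\}$. * $T$ is *H-monotone* if $\langle v'-v,\ \xi_1(g')-\xi_1(g)\rangle\ge 0$ for all $g\in\mathrm{dom}(T)$, $g'\in\mathrm{dom}(T)\cap H_g$, $v\in T(g)$, $v'\in T(g')$. * $T$ is *H-cyclically monotone* if for every $n\ge 1$, all $g_0,\dots,g_n\in\mathbb{H}$ with $g_{i+1}\in H_{g_i}$ for $0\le i\le n-1$ and $g_n\in H_{g_0}$, and all $v_i\in T(g_i)$, one has $\sum_{i=0}^n\langle\xi_1(g_{i+1}),v_i\rangle\le\sum_{i=0}^n\langle\xi_1(g_i),v_i\rangle$,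 where $g_{n+1}=g_0$. * $T$ is *maximal H-monotone* (respectively *maximal H-cyclically monotone*) if $T$ is H-monotone (respectively H-cyclically monotone) and there is no H-monotone (respectively H-cyclically monotone) map $T':\mathbb{H}\rightrightarrows V_1$ such that $T(g)\subseteq T'(g)$ for every $g\in\mathbb{H}$ and $T(g')\subsetneq T'(g')$ for some $g'\in\mathbb{H}$. For $\lambda>0$ let $\xi_1+\lambda T$ be the set-valued map $g\mapsto\{\xi_1(g)+\lambda v : v\in T(g)\}$; its restriction to $H_g$ is surjective onto $V_1$ if $\bigcup_{g'\in H_g}(\xi_1+\lambda T)(g')=V_1$. **Theorem.** Let $T:\mathbb{H}\rightrightarrows V_1$ be H-monotone with $\mathrm{dom}(T)=\mathbb{H}$, and let $\lambda>0$. 1. If $T$ is maximal H-cyclically monotone, then $(\xi_1+\lambda T)|_{H_g}$ is surjective onto $V_1$ for every $g\in\mathbb{H}$. 2. Conversely, if $(\xi_1+\lambda T)|_{H_g}$ is surjective onto $V_1$ for every $g\in\mathbb{H}$, then $T$ is maximal H-monotone. -/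

import Mathlib

/-- The underlying manifold `ℝ³` of the Heisenberg group, with coordinates `(x, y, t)`. -/
@[ext]
structure Heisenberg where
  x : ℝ
  y : ℝ
  t : ℝ

namespace Heisenberg

/-- The Heisenberg group law
`(x, y, t) ∘ (x', y', t') = (x + x', y + y', t + t' + 2 (x' y - x y'))`, with unit `(0, 0, 0)` and
inverse `(-x, -y, -t)`. -/
instance instGroup : Group Heisenberg where
  mul g h := ⟨g.x + h.x, g.y + h.y, g.t + h.t + 2 * (h.x * g.y - g.x * h.y)⟩
  one := ⟨0, 0, 0⟩
  inv g := ⟨-g.x, -g.y, -g.t⟩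
  mul_assoc a b c := by
    refine Heisenberg.ext ?_ ?_ ?_
    · change a.x + b.x + c.x = a.x + (b.x + c.x)
      ring
    · change a.y + b.y + c.y = a.y + (b.y + c.y)
      ring
    · change a.t + b.t + 2 * (b.x * a.y - a.x * b.y) + c.t +
          2 * (c.x * (a.y + b.y) - (a.x + b.x) * c.y) =
        a.t + (b.t + c.t + 2 * (c.x * b.y - b.x * c.y)) +
          2 * ((b.x + c.x) * a.y - a.x * (b.y + c.y))
      ring
  one_mul a := by
    refine Heisenberg.ext ?_ ?_ ?_
    · change 0 + a.x = a.x
      ring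
    · change 0 + a.y = a.y
      ring
    · change 0 + a.t + 2 * (a.x * 0 - 0 * a.y) = a.t
      ring
  mul_one a := by
    refine Heisenberg.ext ?_ ?_ ?_
    · change a.x + 0 = a.x
      ring
    · change a.y + 0 = a.y
      ring
    · change a.t + 0 + 2 * (0 * a.y - a.x * 0) = a.t
      ring
  inv_mul_cancel a := by
    refine Heisenberg.ext ?_ ?_ ?_
    · change -a.x + a.x = 0
      ring
    · change -a.y + a.y = 0
      ring
    · change -a.t + a.t + 2 * (a.x * -a.y - -a.x * a.y) = 0
      ring

/-- The first layer `V₁ = span {X, Y}` of the Lie algebra, identified with the Euclidean plane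
through the basis `X, Y`. -/
abbrev V₁ : Type := EuclideanSpace ℝ (Fin 2)

/-- The exponential map restricted to the first layer, `α X + β Y ↦ (α, β, 0)`. -/
def exp (w : V₁) : Heisenberg := ⟨w 0, w 1, 0⟩

/-- The first-layer component `ξ₁ (x, y, t) = (x, y)` of the inverse of the exponential map. -/
noncomputable def ξ₁ (g : Heisenberg) : V₁ := !₂[g.x, g.y]

/-- The horizontal plane `H_g = {g ∘ exp w : w ∈ V₁}` associated to `g`. -/
def horizontalPlane (g : Heisenberg) : Set Heisenberg :=
  Set.range fun w : V₁ => g * exp w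

/-- The domain of a set-valued map `T : ℍ ⇉ V₁`. -/
def dom (T : Heisenberg → Set V₁) : Set Heisenberg := {g | (T g).Nonempty}

/-- The graph of a set-valued map `T : ℍ ⇉ V₁`. -/
def gph (T : Heisenberg → Set V₁) : Set (Heisenberg × V₁) := {p | p.2 ∈ T p.1}

/-- H-monotonicity of a set-valued map (that `g, g'` lie in the domain is implied by `v ∈ T g` and
`v' ∈ T g'`). -/
def HMonotone (T : Heisenberg → Set V₁) : Prop :=
  ∀ g : Heisenberg, ∀ g' ∈ horizontalPlane g, ∀ v ∈ T g, ∀ v' ∈ T g',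
    0 ≤ inner ℝ (v' - v) (ξ₁ g' - ξ₁ g)

/-- A closed H-sequence `g₀, …, gₙ`: `g_{i+1} ∈ H_{g_i}` for `i = 0, …, n - 1`, and
`gₙ ∈ H_{g₀}`. -/
def IsClosedHSequence {n : ℕ} (g : Fin (n + 1) → Heisenberg) : Prop :=
  (∀ i : Fin n, g i.succ ∈ horizontalPlane (g i.castSucc)) ∧
    g (Fin.last n) ∈ horizontalPlane (g 0)

/-- H-cyclically monotone subsets of `ℍ × V₁`. The index `i + 1` is computed cyclically in
`Fin (n + 1)`, which is the convention `g_{n+1} = g₀`. -/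
def HCyclicallyMonotoneSet (R : Set (Heisenberg × V₁)) : Prop :=
  ∀ n : ℕ, 0 < n → ∀ (g : Fin (n + 1) → Heisenberg) (v : Fin (n + 1) → V₁),
    (∀ i, (g i, v i) ∈ R) → IsClosedHSequence g →
      ∑ i, inner ℝ (ξ₁ (g (i + 1))) (v i) ≤ ∑ i, inner ℝ (ξ₁ (g i)) (v i)

/-- A set-valued map is H-cyclically monotone if its graph is. -/
def HCyclicallyMonotone (T : Heisenberg → Set V₁) : Prop :=
  HCyclicallyMonotoneSet (gph T)

/-- Maximality of a set-valued map `T` with respect to a property `P` of set-valued maps: `T` has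
the property, and no map with the property contains `T` pointwise, strictly at some point. -/
def IsMaximalMap (P : (Heisenberg → Set V₁) → Prop) (T : Heisenberg → Set V₁) : Prop :=
  P T ∧ ¬ ∃ T' : Heisenberg → Set V₁, P T' ∧ (∀ g, T g ⊆ T' g) ∧ ∃ g', T g' ⊂ T' g'

/-- Maximal H-monotone set-valued maps. -/
def MaximalHMonotone (T : Heisenberg → Set V₁) : Prop :=
  IsMaximalMap HMonotone T

/-- Maximal H-cyclically monotone set-valued maps. -/
def MaximalHCyclicallyMonotone (T : Heisenberg → Set V₁) : Prop :=
  IsMaximalMap HCyclicallyMonotone T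

/-- The set-valued map `ξ₁ + lam T`, sending `g` to `{ξ₁ g + lam v : v ∈ T g}`. -/
def addSmul (lam : ℝ) (T : Heisenberg → Set V₁) : Heisenberg → Set V₁ :=
  fun g => (fun v => ξ₁ g + lam • v) '' T g

/-- The restriction of the set-valued map `S` to the set `A` is surjective onto `V₁`: the union of
its values is all of `V₁`. -/
def SurjectiveOn (S : Heisenberg → Set V₁) (A : Set Heisenberg) : Prop :=
  ⋃ g ∈ A, S g = Set.univ

end Heisenberg

/-! The converse is Minty's argument: if a monotone extension of `T` has value `v'` at `g'`,
surjectivity gives a point of `T` on the plane of `g'` solving the same resolvent equation, and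
monotonicity forces the two to coincide.

For the direct part, summing increments along H-chains (Rockafellar) gives a function `u` whose
horizontal subdifferential contains `T`; maximality makes them equal, so `u` has a horizontal
subgradient at every point. This alone makes `u` continuous. Minimising `u` plus a quadratic on
`H_g` would not suffice: a subgradient at `g * exp w` must support `u` on the plane of `g * exp w`,
which is not `H_g` for `w ≠ 0`. Instead `w + lam • v = z` is solved topologically
(`EuclideanSpace.exists_add_smul_subgradient`). Continuity of `u` makes the subgradients locally
bounded with closed graph. Both `g` and `g * exp w` lie on each other's planes, which bounds `inner
ℝ v w` below, so `w + lam • v - z` points outwards on a large circle. Continuous approximate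
selections then have zeros, and these accumulate at a solution. -/

open Filter Topology

/-! ### Zeros of outward-pointing plane vector fields -/

/-- A continuous vector field on a plane disc which points outwards along the boundary circle
vanishes somewhere in the disc. -/
theorem Complex.exists_eq_zero_of_inner_pos {f : ℂ → ℂ} (hf : Continuous f) {R : ℝ} (hR : 0 < R)
    (hpos : ∀ w : ℂ, ‖w‖ = R → 0 < inner ℝ w (f w)) : ∃ w : ℂ, ‖w‖ ≤ R ∧ f w = 0 := by
  by_contra! hne
  let r : ℂ → ℂ := fun w => ((R / max R ‖w‖ : ℝ) : ℂ) * w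
  have hmax : ∀ w : ℂ, 0 < max R ‖w‖ := fun w => lt_max_of_lt_left hR
  have hr : Continuous r := by
    refine Continuous.mul (Complex.continuous_ofReal.comp ?_) continuous_id
    exact continuous_const.div (continuous_const.max continuous_norm) fun w => (hmax w).ne'
  have hr_norm : ∀ w, ‖r w‖ ≤ R := by
    intro w
    simp only [r, norm_mul, Complex.norm_real, Real.norm_eq_abs]
    rw [abs_of_nonneg (div_nonneg hR.le (hmax w).le), div_mul_eq_mul_div, div_le_iff₀ (hmax w)]
    exact mul_le_mul_of_nonneg_left (le_max_right _ _) hR.le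
  have hr_eq : ∀ w, ‖w‖ = R → r w = w := by
    intro w hw
    simp [r, hw, hR.ne']
  -- Composing with the radial retraction onto the disc gives a nonvanishing map on all of `ℂ`,
  -- which therefore has a continuous logarithm.
  let F : C(ℂ, ℂ) := ⟨fun w => f (r w), hf.comp hr⟩
  have hF : ∀ w, F w ∈ ({0}ᶜ : Set ℂ) := fun w => hne _ (hr_norm w)
  obtain ⟨h, ⟨-, hh⟩, -⟩ := Complex.isCoveringMapOn_exp.existsUnique_continuousMap_lifts F
    (a₀ := 0) (e₀ := Complex.log (F 0)) (Complex.exp_log (hF 0)) hF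
  let c : ℝ → ℂ := fun θ => R * Complex.exp (θ * Complex.I)
  have hc : Continuous c := by fun_prop
  have hc_norm : ∀ θ, ‖c θ‖ = R := by
    intro θ
    simp [c, Complex.norm_exp_ofReal_mul_I, abs_of_pos hR]
  -- The angle from the radius to the field: its cosine stays positive, yet one turn lowers it by
  -- `2π`, so it passes through `k 0 - π`.
  let k : ℝ → ℝ := fun θ => (h (c θ)).im - θ
  have hk : Continuous k := by fun_prop
  have hcos : ∀ θ, 0 < Real.cos (k θ) := by
    intro θ
    have h1 := hpos (c θ) (hc_norm θ)
    have h2 : Complex.exp (h (c θ)) = f (c θ) := by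
      refine (congrFun hh (c θ)).trans ?_
      simp [F, hr_eq _ (hc_norm θ)]
    rw [← h2, Complex.inner, mul_comm] at h1
    have h3 : (starRingEnd ℂ (c θ) * Complex.exp (h (c θ))).re
        = R * Real.exp (h (c θ)).re * Real.cos (k θ) := by
      simp only [c, k, map_mul, Complex.conj_ofReal, ← Complex.exp_conj, Complex.conj_I]
      rw [mul_assoc, ← Complex.exp_add, Complex.re_ofReal_mul, Complex.exp_re]
      simp [mul_assoc]
      left
      ring_nf
    rw [h3] at h1
    exact (pos_iff_pos_of_mul_pos h1).1 (mul_pos hR (Real.exp_pos _))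
  have hk2 : k (2 * Real.pi) = k 0 - 2 * Real.pi := by
    have : c (2 * Real.pi) = c 0 := by simp [c]
    simp [k, this]
  have hIVT := intermediate_value_univ (2 * Real.pi) 0 hk
  obtain ⟨θ, hθ⟩ := hIVT (show k 0 - Real.pi ∈ Set.Icc _ _ from
    ⟨by rw [hk2]; linarith [Real.pi_pos], by linarith [Real.pi_pos]⟩)
  have h1 := hcos θ
  rw [hθ, Real.cos_sub_pi] at h1
  linarith [hcos 0]

/-- The same statement in the Euclidean plane. -/
theorem EuclideanSpace.exists_eq_zero_of_inner_pos
    {f : EuclideanSpace ℝ (Fin 2) → EuclideanSpace ℝ (Fin 2)} (hf : Continuous f) {R : ℝ}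
    (hR : 0 < R) (hpos : ∀ w, ‖w‖ = R → 0 < inner ℝ w (f w)) : ∃ w, ‖w‖ ≤ R ∧ f w = 0 := by
  let e := Complex.orthonormalBasisOneI.repr
  obtain ⟨w, hw, hfw⟩ := Complex.exists_eq_zero_of_inner_pos (f := fun z => e.symm (f (e z)))
    (e.symm.continuous.comp (hf.comp e.continuous)) hR (fun z hz => by
      have := hpos (e z) (by rw [e.norm_map, hz])
      rwa [← e.inner_map_map, e.apply_symm_apply])
  exact ⟨e w, by rwa [e.norm_map], by simpa using hfw⟩

/-! ### Solving an inclusion for a field of subgradients -/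

open Metric in
/-- A Kakutani-type inclusion for a field of subgradients. The number `U w p` is the value of a
function at the point reached from `w` by the increment `p`, and `S w` is a nonempty set of
subgradients of `U w` at `0`. -/
theorem EuclideanSpace.exists_add_smul_subgradient
    {U : EuclideanSpace ℝ (Fin 2) → EuclideanSpace ℝ (Fin 2) → ℝ}
    (hU : Continuous fun q : EuclideanSpace ℝ (Fin 2) × EuclideanSpace ℝ (Fin 2) => U q.1 q.2)
    (hback : ∀ w, U w (-w) = U 0 0) (hforth : ∀ w, U 0 w = U w 0)
    (hsub : ∀ w, ∃ v, ∀ p, U w 0 + inner ℝ v p ≤ U w p)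
    {lam : ℝ} (hlam : 0 < lam) (z : EuclideanSpace ℝ (Fin 2)) :
    ∃ w v, w + lam • v = z ∧ ∀ p, U w 0 + inner ℝ v p ≤ U w p := by
  let S : EuclideanSpace ℝ (Fin 2) → Set (EuclideanSpace ℝ (Fin 2)) :=
    fun w => {v | ∀ p, U w 0 + inner ℝ v p ≤ U w p}
  obtain ⟨v₀, hv₀⟩ := hsub 0
  -- Combines the subgradient inequality at `w` towards the base point with the one for `v₀` from
  -- the base point to `w`.
  have hcoer : ∀ w, ∀ v ∈ S w, -(‖v₀‖ * ‖w‖) ≤ inner ℝ v w := by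
    intro w v hv
    have h1 := hv (-w)
    have h2 := hv₀ w
    rw [hback, inner_neg_right] at h1
    rw [hforth w] at h2
    have h3 := neg_le_of_abs_le (abs_real_inner_le_norm v₀ w)
    linarith
  -- Large enough that the term `R * R` beats the losses `lam * (‖v₀‖ * (R + 1) + 1)` and `R * ‖z‖`
  -- on the circle of radius `R`.
  set R : ℝ := lam * (2 * ‖v₀‖ + 1) + ‖z‖ + 1 with hRdef
  have hR1 : 1 ≤ R := by
    have : 0 ≤ lam * (2 * ‖v₀‖ + 1) := by positivity
    have := norm_nonneg z
    linarith
  have hR : 0 < R := by linarith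
  obtain ⟨M, hM⟩ : ∃ M, ∀ w, ‖w‖ ≤ R + 1 → ∀ v ∈ S w, ‖v‖ ≤ M := by
    obtain ⟨C, hC⟩ := ((isCompact_closedBall (0 : EuclideanSpace ℝ (Fin 2)) (R + 1)).prod
      (isCompact_closedBall (0 : EuclideanSpace ℝ (Fin 2)) 1)).exists_bound_of_continuousOn
      hU.continuousOn
    refine ⟨2 * C, fun w hw v hv => ?_⟩
    have hle : ∀ p, ‖p‖ ≤ 1 → |U w p| ≤ C := fun p hp =>
      hC (w, p) ⟨by simpa using hw, by simpa using hp⟩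
    have h0 := abs_le.1 (hle 0 (by simp))
    rcases eq_or_ne v 0 with rfl | hv0
    · simp only [norm_zero]; linarith [h0.1, h0.2]
    have hn : ‖v‖ ≠ 0 := norm_ne_zero_iff.2 hv0
    have h1 := abs_le.1 (hle (‖v‖⁻¹ • v) (by simp [norm_smul, hn]))
    have h2 := hv (‖v‖⁻¹ • v)
    rw [inner_smul_right, real_inner_self_eq_norm_mul_norm, inv_mul_cancel_left₀ hn] at h2
    linarith [h0.1, h1.2]
  have happrox : ∀ δ > 0, δ ≤ 1 → δ * M ≤ 1 → ∃ w v, ‖w‖ ≤ R ∧ w + lam • v = z ∧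
      v ∈ convexHull ℝ (⋃ w' ∈ ball w δ, S w') := by
    intro δ hδ hδ1 hδM
    -- A subgradient at `w` is admissible at all points within `δ` of `w`, so convexity lets a
    -- partition of unity glue these constants.
    obtain ⟨F, hF⟩ := exists_continuous_forall_mem_convex_of_local_const
      (t := fun w => convexHull ℝ (⋃ w' ∈ ball w δ, S w')) (fun w => convex_convexHull ℝ _)
      (fun w => by
        obtain ⟨v, hv⟩ := hsub w
        refine ⟨v, ?_⟩
        filter_upwards [ball_mem_nhds w hδ] with y hy
        exact subset_convexHull ℝ _ (Set.mem_biUnion (mem_ball_comm.1 hy) hv))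
    obtain ⟨w, hwR, hw⟩ := EuclideanSpace.exists_eq_zero_of_inner_pos
      (f := fun w => w + lam • F w - z) (by fun_prop) hR (fun w hw => by
        -- The lower bound defines a half-space, so it passes from nearby subgradients to their
        -- convex hull; `δ * M ≤ 1` pays for replacing `w'` by `w`.
        have hhalf : F w ∈ {v | -(‖v₀‖ * (R + 1)) - 1 ≤ inner ℝ w v} := by
          refine convexHull_min ?_ ?_ (hF w)
          · intro v hv
            simp only [Set.mem_iUnion] at hv
            obtain ⟨w', hw', hv⟩ := hv
            have hd : ‖w - w'‖ < δ := by rwa [← dist_eq_norm, dist_comm]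
            have hw'n : ‖w'‖ ≤ R + 1 := by
              have := norm_le_norm_add_norm_sub w w'
              linarith
            have h1 := hcoer w' v hv
            have h2 := hM w' hw'n v hv
            have h3 := neg_le_of_abs_le (abs_real_inner_le_norm v (w - w'))
            have h4 : ‖v‖ * ‖w - w'‖ ≤ M * δ := mul_le_mul h2 hd.le (norm_nonneg _)
              ((norm_nonneg _).trans h2)
            have h5 : ‖v₀‖ * ‖w'‖ ≤ ‖v₀‖ * (R + 1) :=
              mul_le_mul_of_nonneg_left hw'n (norm_nonneg _)
            have h6 : inner ℝ w v = inner ℝ v w' + inner ℝ v (w - w') := by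
              rw [← inner_add_right, real_inner_comm]; simp
            simp only [Set.mem_ofPred_eq]
            linarith
          · exact convex_halfSpace_ge (innerₛₗ ℝ w).isLinear _
        have h1 : -(‖v₀‖ * (R + 1)) - 1 ≤ inner ℝ w (F w) := hhalf
        have h2 := real_inner_le_norm w z
        rw [inner_sub_right, inner_add_right, inner_smul_right, real_inner_self_eq_norm_mul_norm]
        rw [hw] at h2 ⊢
        have h3 := mul_le_mul_of_nonneg_left h1 hlam.le
        have h4 : lam * (‖v₀‖ * (R + 1) + 1) ≤ lam * (2 * ‖v₀‖ + 1) * R := by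
          have : ‖v₀‖ * (R + 1) + 1 ≤ (2 * ‖v₀‖ + 1) * R := by nlinarith [norm_nonneg v₀]
          rw [mul_assoc]
          exact mul_le_mul_of_nonneg_left this hlam.le
        have h5 : R * R = lam * (2 * ‖v₀‖ + 1) * R + R * ‖z‖ + R := by
          conv_lhs => rw [hRdef]
          rw [hRdef]; ring
        linarith)
    exact ⟨w, F w, hwR, sub_eq_zero.1 hw, hF w⟩
  let δ : ℕ → ℝ := fun n => 1 / ((n : ℝ) + 1) * (|M| + 1)⁻¹
  have hδ0 : ∀ n, 0 < δ n := fun n => by positivity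
  have hδlim : Tendsto δ atTop (𝓝 0) := by
    simpa [δ] using (tendsto_one_div_add_atTop_nhds_zero_nat (𝕜 := ℝ)).mul_const (|M| + 1)⁻¹
  have hM0 : (|M| + 1)⁻¹ ≤ 1 := inv_le_one_of_one_le₀ (by linarith [abs_nonneg M])
  have hδ' : ∀ n, δ n ≤ (|M| + 1)⁻¹ := fun n => by
    have : 1 / ((n : ℝ) + 1) ≤ 1 := by
      rw [div_le_one (by positivity)]; linarith [Nat.cast_nonneg (α := ℝ) n]
    exact mul_le_of_le_one_left (by positivity) this
  have hδM : ∀ n, δ n * M ≤ 1 := fun n => by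
    have h1 : δ n * M ≤ δ n * (|M| + 1) :=
      mul_le_mul_of_nonneg_left (by linarith [le_abs_self M]) (hδ0 n).le
    have h2 : δ n * (|M| + 1) ≤ (|M| + 1)⁻¹ * (|M| + 1) :=
      mul_le_mul_of_nonneg_right (hδ' n) (by positivity)
    rw [inv_mul_cancel₀ (by positivity)] at h2
    linarith
  choose w v hwR hwv hv using fun n => happrox (δ n) (hδ0 n) ((hδ' n).trans hM0) (hδM n)
  obtain ⟨w₁, -, φ, hφ, hlim⟩ := (isCompact_closedBall (0 : EuclideanSpace ℝ (Fin 2)) R)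
    |>.tendsto_subseq (x := w) fun n => by simpa using hwR n
  have hveq : ∀ n, v n = lam⁻¹ • (z - w n) := fun n => by
    rw [← hwv n, add_sub_cancel_left, smul_smul, inv_mul_cancel₀ hlam.ne', one_smul]
  refine ⟨w₁, lam⁻¹ • (z - w₁), ?_, fun p => ?_⟩
  · rw [smul_smul, mul_inv_cancel₀ hlam.ne', one_smul, add_sub_cancel]
  have hvlim : Tendsto (fun n => inner ℝ (v (φ n)) p) atTop (𝓝 (inner ℝ (lam⁻¹ • (z - w₁)) p)) := by
    simp only [hveq]
    exact ((hlim.const_sub z).const_smul lam⁻¹).inner tendsto_const_nhds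
  rw [← le_sub_iff_add_le']
  refine le_of_forall_pos_le_add fun ε hε => ?_
  have hcont : Continuous fun y => U y p - U y 0 :=
    (hU.comp (continuous_id.prodMk continuous_const)).sub
      (hU.comp (continuous_id.prodMk continuous_const))
  obtain ⟨η, hη, hball⟩ := Metric.continuous_iff.1 hcont w₁ ε hε
  refine le_of_tendsto hvlim ?_
  filter_upwards [Metric.tendsto_nhds.1 hlim (η / 2) (half_pos hη),
    (hδlim.comp hφ.tendsto_atTop).eventually_lt_const (half_pos hη)] with n h1 h2
  -- For fixed `p` the subgradient inequality is a half-space condition on `v`, so it survives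
  -- convex hulls up to `ε`.
  have hhalf : v (φ n) ∈ {v | inner ℝ p v ≤ U w₁ p - U w₁ 0 + ε} := by
    refine convexHull_min ?_ ?_ (hv (φ n))
    · intro v' hv'
      simp only [Set.mem_iUnion] at hv'
      obtain ⟨w', hw', hv'⟩ := hv'
      have h3 := hball w' (by
        have := dist_triangle w' (w (φ n)) w₁
        simp only [mem_ball, Function.comp_apply] at hw' h1 h2
        linarith)
      rw [Real.dist_eq] at h3
      have h4 := hv' p
      have h5 := (abs_lt.1 h3).2
      simp only [Set.mem_ofPred_eq, real_inner_comm v' p]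
      linarith
    · exact convex_halfSpace_le (innerₛₗ ℝ p).isLinear _
  rw [real_inner_comm]
  exact hhalf

/-! ### Horizontal planes and Minty's criterion -/

namespace Heisenberg

theorem mul_exp (g : Heisenberg) (w : V₁) :
    g * exp w = ⟨g.x + w 0, g.y + w 1, g.t + 2 * (w 0 * g.y - g.x * w 1)⟩ := by
  change (⟨_, _, _⟩ : Heisenberg) = _
  simp [exp]

theorem mem_horizontalPlane {g g' : Heisenberg} :
    g' ∈ horizontalPlane g ↔ g'.t = g.t + 2 * (g'.x * g.y - g.x * g'.y) := by
  constructor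
  · rintro ⟨w, rfl⟩
    simp only [mul_exp]
    ring
  · intro h
    refine ⟨!₂[g'.x - g.x, g'.y - g.y], ?_⟩
    simp only [mul_exp]
    ext
    · simp
    · simp
    · simp only [Matrix.cons_val_zero, Matrix.cons_val_one, h]
      ring

theorem mul_exp_mem_horizontalPlane (g : Heisenberg) (w : V₁) : g * exp w ∈ horizontalPlane g :=
  ⟨w, rfl⟩

theorem mem_horizontalPlane_symm {g g' : Heisenberg} (h : g' ∈ horizontalPlane g) :
    g ∈ horizontalPlane g' := by
  rw [mem_horizontalPlane] at h ⊢
  rw [h]; ring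

theorem ξ₁_mul_exp (g : Heisenberg) (w : V₁) : ξ₁ (g * exp w) = ξ₁ g + w := by
  ext i
  fin_cases i <;> simp [mul_exp, ξ₁]

theorem eq_of_mem_horizontalPlane_of_ξ₁_eq {g g' : Heisenberg} (h : g' ∈ horizontalPlane g)
    (hξ : ξ₁ g' = ξ₁ g) : g' = g := by
  have hx : g'.x = g.x := by simpa [ξ₁] using congrFun (congrArg WithLp.ofLp hξ) 0
  have hy : g'.y = g.y := by simpa [ξ₁] using congrFun (congrArg WithLp.ofLp hξ) 1
  rw [mem_horizontalPlane, hx, hy] at h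
  exact Heisenberg.ext hx hy (by rw [h]; ring)

/-- Minty's criterion: surjectivity of `ξ₁ + lam T` on horizontal planes forces maximality. -/
theorem maximalHMonotone_of_surjectiveOn {T : Heisenberg → Set V₁} (hT : HMonotone T) {lam : ℝ}
    (hlam : 0 < lam) (hsurj : ∀ g, SurjectiveOn (addSmul lam T) (horizontalPlane g)) :
    MaximalHMonotone T := by
  refine ⟨hT, ?_⟩
  rintro ⟨T', hT', hle, g', hss⟩
  refine hss.not_subset fun v' hv' => ?_
  have hmem : ξ₁ g' + lam • v' ∈ ⋃ g ∈ horizontalPlane g', addSmul lam T g := by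
    rw [hsurj g']; trivial
  simp only [Set.mem_iUnion] at hmem
  obtain ⟨g, hg, v, hv, hvg⟩ := hmem
  have hdiff : v - v' = -lam⁻¹ • (ξ₁ g - ξ₁ g') := by
    have : lam • (v - v') = -(ξ₁ g - ξ₁ g') := by
      rw [smul_sub, eq_sub_of_add_eq' hvg]; abel
    rw [neg_smul, ← smul_neg, ← this, smul_smul, inv_mul_cancel₀ hlam.ne', one_smul]
  have hmono := hT' g' g hg v' hv' v (hle g hv)
  rw [hdiff, inner_smul_left, real_inner_self_eq_norm_sq] at hmono
  have hξ : ξ₁ g - ξ₁ g' = 0 := by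
    by_contra hne
    have : 0 < lam⁻¹ * ‖ξ₁ g - ξ₁ g'‖ ^ 2 := by positivity
    simp at hmono
    linarith
  have hgg := eq_of_mem_horizontalPlane_of_ξ₁_eq hg (sub_eq_zero.1 hξ)
  rw [hξ, smul_zero, sub_eq_zero] at hdiff
  rwa [← hdiff, ← hgg]

/-! ### H-chains and Rockafellar's potential -/

/-- `HChain T g g' s`: there is an H-chain from `g` to `g'` with values of `T` selected along it,
whose sum of increments is `s`. -/
inductive HChain (T : Heisenberg → Set V₁) : Heisenberg → Heisenberg → ℝ → Prop
  | refl (g : Heisenberg) : HChain T g g 0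
  | cons {g g' g'' : Heisenberg} {v : V₁} {s : ℝ} (hv : v ∈ T g) (hg : g' ∈ horizontalPlane g)
      (h : HChain T g' g'' s) : HChain T g g'' (inner ℝ v (ξ₁ g' - ξ₁ g) + s)

namespace HChain

variable {T : Heisenberg → Set V₁}

theorem single {g g' : Heisenberg} {v : V₁} (hv : v ∈ T g) (hg : g' ∈ horizontalPlane g) :
    HChain T g g' (inner ℝ v (ξ₁ g' - ξ₁ g)) := by
  simpa using cons hv hg (refl g')

theorem trans {g g' g'' : Heisenberg} {s s' : ℝ} (h : HChain T g g' s) (h' : HChain T g' g'' s') :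
    HChain T g g'' (s + s') := by
  induction h with
  | refl g => simpa
  | cons hv hg _ ih => rw [add_assoc]; exact cons hv hg (ih h')

theorem exists_sequence {g g' : Heisenberg} {s : ℝ} (h : HChain T g g' s) :
    ∃ (n : ℕ) (a : ℕ → Heisenberg) (v : ℕ → V₁), (∀ i < n, v i ∈ T (a i)) ∧
      (∀ i < n, a (i + 1) ∈ horizontalPlane (a i)) ∧ a 0 = g ∧ a n = g' ∧
      s = ∑ i ∈ Finset.range n, inner ℝ (v i) (ξ₁ (a (i + 1)) - ξ₁ (a i)) := by
  induction h with
  | refl g => exact ⟨0, fun _ => g, fun _ => 0, by simp⟩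
  | @cons g g' g'' v s hv hg _ ih =>
    obtain ⟨n, a, w, hw, ha, h0, hn, rfl⟩ := ih
    refine ⟨n + 1, fun i => Nat.casesOn i g a, fun i => Nat.casesOn i v w, ?_, ?_, rfl, hn, ?_⟩
    · rintro (_ | i) hi
      · exact hv
      · exact hw i (by omega)
    · rintro (_ | i) hi
      · change a 0 ∈ horizontalPlane g
        rwa [h0]
      · exact ha i (by omega)
    · rw [Finset.sum_range_succ', add_comm]
      change _ = _ + inner ℝ v (ξ₁ (a 0) - ξ₁ g)
      rw [h0]

theorem nonpos_of_closed (hT : HCyclicallyMonotone T) {g : Heisenberg} {s : ℝ}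
    (h : HChain T g g s) : s ≤ 0 := by
  obtain ⟨n, a, v, hv, ha, h0, hn, rfl⟩ := h.exists_sequence
  -- Cyclic monotonicity concerns at least two points; closed chains of at most one step have sum
  -- zero.
  rcases n with _ | _ | n
  · simp
  · simp_all
  · have hcyc := hT (n + 1) n.succ_pos (fun i => a i) (fun i => v i)
      (fun i => hv i i.is_lt) ⟨fun i => by simpa using ha i (by omega), by
        have := mem_horizontalPlane_symm (ha (n + 1) (by omega))
        simpa [hn, h0] using this⟩
    have hnext : ∀ i : Fin (n + 1 + 1), a ((i + 1 : Fin (n + 1 + 1)) : ℕ) = a ((i : ℕ) + 1) := by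
      intro i
      rcases Fin.eq_castSucc_or_eq_last i with ⟨j, rfl⟩ | rfl
      · simp
      · simp [hn, h0]
    simp only [hnext] at hcyc
    rw [Finset.sum_range (fun i => inner ℝ (v i) (ξ₁ (a (i + 1)) - ξ₁ (a i)))]
    simp only [inner_sub_right, Finset.sum_sub_distrib]
    simp only [real_inner_comm (v _)] at hcyc
    linarith

/-- Reversing a chain needs values of `T` at the new starting points, hence the full domain; the
sums are unrelated. -/
theorem exists_symm (hdom : dom T = Set.univ) {g g' : Heisenberg} (h : ∃ s, HChain T g g' s) :
    ∃ s, HChain T g' g s := by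
  obtain ⟨s, h⟩ := h
  induction h with
  | refl g => exact ⟨0, refl g⟩
  | @cons g g' g'' v s hv hg _ ih =>
    obtain ⟨s', hs'⟩ := ih
    obtain ⟨v', hv'⟩ : g' ∈ dom T := hdom ▸ Set.mem_univ g'
    exact ⟨_, hs'.trans (single hv' (mem_horizontalPlane_symm hg))⟩

/-- Any point can be joined to the unit by an H-chain. -/
theorem exists_to_one (hdom : dom T = Set.univ) (g : Heisenberg) :
    ∃ s, HChain T g ⟨0, 0, 0⟩ s := by
  have hstep : ∀ {p q r : Heisenberg}, q ∈ horizontalPlane p → (∃ s, HChain T q r s) →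
      ∃ s, HChain T p r s := by
    rintro p q r hpq ⟨s, hs⟩
    obtain ⟨v, hv⟩ : p ∈ dom T := hdom ▸ Set.mem_univ p
    exact ⟨_, cons hv hpq hs⟩
  refine hstep (q := ⟨0, 0, g.t⟩) (mem_horizontalPlane.2 (by simp)) ?_
  refine hstep (q := ⟨1, 0, g.t⟩) (mem_horizontalPlane.2 (by simp)) ?_
  -- The value `g.t / 2` is the one for which the segment from `(1, 0, g.t)` ends at height zero.
  refine hstep (q := ⟨0, g.t / 2, 0⟩) (mem_horizontalPlane.2 (by simp; ring)) ?_
  exact hstep (q := ⟨0, 0, 0⟩) (mem_horizontalPlane.2 (by simp)) ⟨0, refl _⟩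

end HChain

/-- The horizontal subdifferential of a function on the Heisenberg group. -/
def hSubdifferential (u : Heisenberg → ℝ) (g : Heisenberg) : Set V₁ :=
  {v | ∀ g' ∈ horizontalPlane g, u g + inner ℝ v (ξ₁ g' - ξ₁ g) ≤ u g'}

/-- The increments of `u` bounding the inner products cancel around a closed sequence. -/
theorem hCyclicallyMonotone_hSubdifferential (u : Heisenberg → ℝ) :
    HCyclicallyMonotone (hSubdifferential u) := by
  intro n _ g v hv hg
  have hstep : ∀ i, inner ℝ (ξ₁ (g (i + 1))) (v i) ≤
      inner ℝ (ξ₁ (g i)) (v i) + (u (g (i + 1)) - u (g i)) := by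
    intro i
    have hmem : g (i + 1) ∈ horizontalPlane (g i) := by
      rcases Fin.eq_castSucc_or_eq_last i with ⟨j, rfl⟩ | rfl
      · simpa using hg.1 j
      · simpa using mem_horizontalPlane_symm hg.2
    have h : u (g i) + inner ℝ (v i) (ξ₁ (g (i + 1)) - ξ₁ (g i)) ≤ u (g (i + 1)) := hv i _ hmem
    rw [inner_sub_right, real_inner_comm, real_inner_comm (ξ₁ (g i))] at h
    linarith
  refine (Finset.sum_le_sum fun i _ => hstep i).trans_eq ?_
  have hshift : ∑ i, u (g (i + 1)) = ∑ i, u (g i) :=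
    Equiv.sum_comp (Equiv.addRight (1 : Fin (n + 1))) fun i => u (g i)
  rw [Finset.sum_add_distrib, Finset.sum_sub_distrib, hshift, sub_self, add_zero]

/-- Rockafellar's theorem: a cyclically monotone map with full domain is contained in a
horizontal subdifferential. -/
theorem HCyclicallyMonotone.exists_potential {T : Heisenberg → Set V₁}
    (hT : HCyclicallyMonotone T) (hdom : dom T = Set.univ) :
    ∃ u : Heisenberg → ℝ, ∀ g, T g ⊆ hSubdifferential u g := by
  have hbdd : ∀ g, BddAbove {s | HChain T ⟨0, 0, 0⟩ g s} := by
    intro g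
    obtain ⟨s', hs'⟩ := HChain.exists_to_one hdom g
    -- A fixed chain back to the origin closes up every chain to `g`, so all sums are at most `-s'`.
    exact ⟨-s', fun s hs => by linarith [(HChain.trans hs hs').nonpos_of_closed hT]⟩
  refine ⟨fun g => sSup {s | HChain T ⟨0, 0, 0⟩ g s}, fun g v hv g' hg' => ?_⟩
  rw [← le_sub_iff_add_le]
  refine csSup_le (HChain.exists_symm hdom (HChain.exists_to_one hdom g)) fun s hs => ?_
  rw [le_sub_iff_add_le]
  exact le_csSup (hbdd g') (hs.trans (HChain.single hv hg'))

theorem MaximalHCyclicallyMonotone.exists_eq_hSubdifferential {T : Heisenberg → Set V₁}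
    (hT : MaximalHCyclicallyMonotone T) (hdom : dom T = Set.univ) :
    ∃ u : Heisenberg → ℝ, T = hSubdifferential u := by
  obtain ⟨u, hu⟩ := HCyclicallyMonotone.exists_potential hT.1 hdom
  refine ⟨u, funext fun g => (hu g).antisymm ?_⟩
  by_contra hg
  exact hT.2 ⟨_, hCyclicallyMonotone_hSubdifferential u, hu, g, hu g, hg⟩

end Heisenberg

/-! ### Continuity of horizontally subdifferentiable functions -/

namespace Heisenberg

/-- `(a, b)` is a horizontal subgradient at `p` of the function `f` of the coordinates
`(x, y, t)`. -/
def IsHSubgradient (f : ℝ × ℝ × ℝ → ℝ) (p : ℝ × ℝ × ℝ) (a b : ℝ) : Prop :=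
  ∀ x y, f p + a * (x - p.1) + b * (y - p.2.1) ≤ f (x, y, p.2.2 + 2 * (x * p.2.1 - p.1 * y))

/-- A function of the coordinates that has a horizontal subgradient everywhere. -/
def HSubdifferentiable (f : ℝ × ℝ × ℝ → ℝ) : Prop :=
  ∀ p, ∃ a b, IsHSubgradient f p a b

/-- Left translation, in coordinates. -/
def leftTranslate (q p : ℝ × ℝ × ℝ) : ℝ × ℝ × ℝ :=
  (q.1 + p.1, q.2.1 + p.2.1, q.2.2 + p.2.2 + 2 * (p.1 * q.2.1 - q.1 * p.2.1))

theorem continuous_leftTranslate (q : ℝ × ℝ × ℝ) : Continuous (leftTranslate q) := by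
  unfold leftTranslate
  fun_prop

theorem leftTranslate_neg (q p : ℝ × ℝ × ℝ) : leftTranslate q (leftTranslate (-q) p) = p := by
  ext <;> simp [leftTranslate]
  ring

theorem leftTranslate_neg_self (q : ℝ × ℝ × ℝ) : leftTranslate (-q) q = 0 := by
  ext <;> simp [leftTranslate, mul_comm]

theorem IsHSubgradient.comp_leftTranslate {f : ℝ × ℝ × ℝ → ℝ} {q p : ℝ × ℝ × ℝ} {a b : ℝ}
    (h : IsHSubgradient f (leftTranslate q p) a b) :
    IsHSubgradient (fun r => f (leftTranslate q r)) p a b := by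
  intro x y
  have := h (q.1 + x) (q.2.1 + y)
  simp only [leftTranslate] at this ⊢
  refine le_trans (le_of_eq ?_) (this.trans (le_of_eq ?_))
  · ring
  · congr 3
    ring

theorem HSubdifferentiable.comp_leftTranslate {f : ℝ × ℝ × ℝ → ℝ} (hf : HSubdifferentiable f)
    (q : ℝ × ℝ × ℝ) : HSubdifferentiable fun p => f (leftTranslate q p) := by
  intro p
  obtain ⟨a, b, h⟩ := hf (leftTranslate q p)
  exact ⟨a, b, h.comp_leftTranslate⟩

/-- The parameter at which the horizontal plane of `g` meets the horizontal line
`s ↦ (p₁ - s p₂, p₂ + s p₁, -2 s)`, for a unit vector `p`. -/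
noncomputable def planeParam (p : ℝ × ℝ) (g : ℝ × ℝ × ℝ) : ℝ :=
  -(g.2.2 + 2 * (p.1 * g.2.1 - g.1 * p.2)) / (2 - 2 * (p.1 * g.1 + p.2 * g.2.1))

/-- The horizontal line through `(p₁, p₂, 0)` perpendicular to `p`, for a unit vector `p`. -/
def tangentLine (p : ℝ × ℝ) (s : ℝ) : ℝ × ℝ × ℝ := (p.1 - s * p.2, p.2 + s * p.1, -2 * s)

theorem eventually_planeParam_denom (p : ℝ × ℝ) :
    ∀ᶠ g : ℝ × ℝ × ℝ in 𝓝 0, (2 - 2 * (p.1 * g.1 + p.2 * g.2.1)) ≠ 0 := by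
  have h : ContinuousAt (fun g : ℝ × ℝ × ℝ => 2 - 2 * (p.1 * g.1 + p.2 * g.2.1)) 0 := by fun_prop
  exact h.eventually_ne (by simp)

theorem tendsto_planeParam (p : ℝ × ℝ) : Tendsto (planeParam p) (𝓝 0) (𝓝 0) := by
  have h : ContinuousAt (planeParam p) 0 := by
    unfold planeParam
    exact ContinuousAt.div (by fun_prop) (by fun_prop) (by simp)
  simpa [ContinuousAt, planeParam] using h

theorem tendsto_tangentLine_planeParam (p : ℝ × ℝ) :
    Tendsto (fun g => tangentLine p (planeParam p g)) (𝓝 0) (𝓝 (p.1, p.2, 0)) := by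
  have h : Continuous (tangentLine p) := by unfold tangentLine; fun_prop
  have h0 : tangentLine p 0 = (p.1, p.2, 0) := by simp [tangentLine]
  exact h0 ▸ (h.tendsto 0).comp (tendsto_planeParam p)

/-- The intersection point does lie in the horizontal plane. -/
theorem tangentLine_planeParam_t {p : ℝ × ℝ} {g : ℝ × ℝ × ℝ}
    (hg : 2 - 2 * (p.1 * g.1 + p.2 * g.2.1) ≠ 0) :
    (tangentLine p (planeParam p g)).2.2 = g.2.2 +
      2 * ((tangentLine p (planeParam p g)).1 * g.2.1 - g.1 * (tangentLine p (planeParam p g)).2.1)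
    := by
  have h : planeParam p g * (2 - 2 * (p.1 * g.1 + p.2 * g.2.1)) =
      -(g.2.2 + 2 * (p.1 * g.2.1 - g.1 * p.2)) := div_mul_cancel₀ _ hg
  simp only [tangentLine]
  linarith

theorem tangentLine_t {p : ℝ × ℝ} (hp : p.1 ^ 2 + p.2 ^ 2 = 1) (s s' : ℝ) :
    (tangentLine p s').2.2 = (tangentLine p s).2.2 + 2 * ((tangentLine p s').1 *
      (tangentLine p s).2.1 - (tangentLine p s).1 * (tangentLine p s').2.1) := by
  simp only [tangentLine]
  linear_combination (2 * (s' - s)) * hp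

/-- The subgradient inequality between two points of the same horizontal plane. -/
theorem IsHSubgradient.le {f : ℝ × ℝ × ℝ → ℝ} {p q : ℝ × ℝ × ℝ} {a b : ℝ}
    (h : IsHSubgradient f p a b) (hq : q.2.2 = p.2.2 + 2 * (q.1 * p.2.1 - p.1 * q.2.1)) :
    f p + a * (q.1 - p.1) + b * (q.2.1 - p.2.1) ≤ f q := by
  have := h q.1 q.2.1
  rwa [← hq] at this

namespace HSubdifferentiable

variable {f : ℝ × ℝ × ℝ → ℝ}

/-- The line is horizontal, so a subgradient at an interior point makes one of the two endpoint
values at least as large. -/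
theorem bddAbove_tangentLine (hf : HSubdifferentiable f) {p : ℝ × ℝ} (hp : p.1 ^ 2 + p.2 ^ 2 = 1) :
    ∃ M, ∀ s, |s| ≤ 1 → f (tangentLine p s) ≤ M := by
  refine ⟨max (f (tangentLine p 1)) (f (tangentLine p (-1))), fun s hs => ?_⟩
  obtain ⟨a, b, hab⟩ := hf (tangentLine p s)
  have h1 := hab.le (tangentLine_t hp s 1)
  have h2 := hab.le (tangentLine_t hp s (-1))
  simp only [tangentLine] at h1 h2 ⊢
  obtain ⟨hs1, hs2⟩ := abs_le.1 hs
  rw [le_max_iff]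
  rcases le_total 0 (b * p.1 - a * p.2) with h | h
  · left
    nlinarith [mul_nonneg h (sub_nonneg.2 hs2)]
  · right
    nlinarith [mul_nonneg (neg_nonneg.2 h) (neg_le_iff_add_nonneg'.1 hs1)]

/-- The plane of `g` meets the tangent line near `p`, where `f` is bounded above; the quarter
absorbs the error in the direction `p`. -/
theorem eventually_add_le (hf : HSubdifferentiable f) {p : ℝ × ℝ} (hp : p.1 ^ 2 + p.2 ^ 2 = 1) :
    ∃ M, ∀ᶠ g in 𝓝 (0 : ℝ × ℝ × ℝ), ∀ a b, IsHSubgradient f g a b →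
      f g + a * p.1 + b * p.2 - (|a| + |b|) / 4 ≤ M := by
  obtain ⟨M, hM⟩ := hf.bddAbove_tangentLine hp
  refine ⟨M, ?_⟩
  have hlim := tendsto_tangentLine_planeParam p
  have hw1 : Tendsto (fun g : ℝ × ℝ × ℝ => (tangentLine p (planeParam p g)).1 - g.1) (𝓝 0)
      (𝓝 p.1) := by
    simpa using ((continuous_fst.tendsto _).comp hlim).sub
      (continuous_fst.tendsto (0 : ℝ × ℝ × ℝ))
  have hw2 : Tendsto (fun g : ℝ × ℝ × ℝ => (tangentLine p (planeParam p g)).2.1 - g.2.1) (𝓝 0)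
      (𝓝 p.2) := by
    simpa using (((continuous_fst.comp continuous_snd).tendsto _).comp hlim).sub
      ((continuous_fst.comp continuous_snd).tendsto (0 : ℝ × ℝ × ℝ))
  filter_upwards [eventually_planeParam_denom p,
    Metric.tendsto_nhds.1 (tendsto_planeParam p) 1 one_pos,
    Metric.tendsto_nhds.1 hw1 (1 / 4) (by norm_num),
    Metric.tendsto_nhds.1 hw2 (1 / 4) (by norm_num)] with g h1 h2 h3 h4 a b hab
  have h5 := hab.le (tangentLine_planeParam_t h1)
  have h6 := hM (planeParam p g) (by simpa [Real.dist_eq] using h2.le)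
  rw [Real.dist_eq] at h3 h4
  set w1 := (tangentLine p (planeParam p g)).1 - g.1
  set w2 := (tangentLine p (planeParam p g)).2.1 - g.2.1
  have h7 : |a * (w1 - p.1)| ≤ |a| * (1 / 4) := by
    rw [abs_mul]; exact mul_le_mul_of_nonneg_left h3.le (abs_nonneg a)
  have h8 : |b * (w2 - p.2)| ≤ |b| * (1 / 4) := by
    rw [abs_mul]; exact mul_le_mul_of_nonneg_left h4.le (abs_nonneg b)
  have h9 := (abs_le.1 h7).1
  have h10 := (abs_le.1 h8).1
  linarith

/-- Upper bound near the origin, with control of the subgradients. -/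
theorem eventually_zero_upper (hf : HSubdifferentiable f) :
    ∃ M, ∀ᶠ g in 𝓝 (0 : ℝ × ℝ × ℝ), ∀ a b, IsHSubgradient f g a b →
      f g + (|a| + |b|) / 4 ≤ M := by
  obtain ⟨M1, h1⟩ := hf.eventually_add_le (p := (1, 0)) (by norm_num)
  obtain ⟨M2, h2⟩ := hf.eventually_add_le (p := (-1, 0)) (by norm_num)
  obtain ⟨M3, h3⟩ := hf.eventually_add_le (p := (0, 1)) (by norm_num)
  obtain ⟨M4, h4⟩ := hf.eventually_add_le (p := (0, -1)) (by norm_num)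
  refine ⟨max (max M1 M2) (max M3 M4), ?_⟩
  filter_upwards [h1, h2, h3, h4] with g h1 h2 h3 h4 a b hab
  have h1 := h1 a b hab
  have h2 := h2 a b hab
  have h3 := h3 a b hab
  have h4 := h4 a b hab
  simp only [le_max_iff]
  -- The direction aligned with the larger component yields `max |a| |b|`, at least half of `|a| +
  -- |b|`; a quarter is left.
  rcases le_total |b| |a| with h | h
  · rcases abs_cases a with ⟨ha, _⟩ | ⟨ha, _⟩
    · left; left; linarith
    · left; right; linarith
  · rcases abs_cases b with ⟨hb, _⟩ | ⟨hb, _⟩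
    · right; left; linarith
    · right; right; linarith

theorem eventually_upper (hf : HSubdifferentiable f) (q : ℝ × ℝ × ℝ) :
    ∃ M, ∀ᶠ g in 𝓝 q, ∀ a b, IsHSubgradient f g a b → f g + (|a| + |b|) / 4 ≤ M := by
  obtain ⟨M, hM⟩ := (hf.comp_leftTranslate q).eventually_zero_upper
  refine ⟨M, ?_⟩
  have hlim := (continuous_leftTranslate (-q)).tendsto q
  rw [leftTranslate_neg_self] at hlim
  filter_upwards [hlim.eventually hM] with g hg a b hab
  have := hg a b (IsHSubgradient.comp_leftTranslate (by rwa [leftTranslate_neg]))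
  rwa [leftTranslate_neg] at this

/-- From a point near `(1, 0, 0)` on the plane of `g`, a subgradient bounds `f g` below. Its size is
at most four times the gap between `M` and the value there, and that value is bounded below along
the tangent line. -/
theorem eventually_zero_lower (hf : HSubdifferentiable f) :
    ∃ m, ∀ᶠ g in 𝓝 (0 : ℝ × ℝ × ℝ), m ≤ f g := by
  have hp : ((1, 0) : ℝ × ℝ).1 ^ 2 + ((1, 0) : ℝ × ℝ).2 ^ 2 = 1 := by norm_num
  obtain ⟨M, hM⟩ := hf.eventually_upper (1, 0, 0)
  obtain ⟨a₀, b₀, h₀⟩ := hf (tangentLine (1, 0) 0)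
  have hlim := tendsto_tangentLine_planeParam (1, 0)
  have hpar := tendsto_planeParam (1, 0)
  have hx : ∀ᶠ g : ℝ × ℝ × ℝ in 𝓝 0, |g.1| < 1 := by
    have := Metric.tendsto_nhds.1 (continuous_fst.tendsto (0 : ℝ × ℝ × ℝ)) 1 one_pos
    simpa [Real.dist_eq] using this
  have hy : ∀ᶠ g : ℝ × ℝ × ℝ in 𝓝 0, |g.2.1| < 1 := by
    have := Metric.tendsto_nhds.1
      ((continuous_fst.comp continuous_snd).tendsto (0 : ℝ × ℝ × ℝ)) 1 one_pos
    simpa [Real.dist_eq] using this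
  refine ⟨9 * (f (tangentLine (1, 0) 0) - |b₀|) - 8 * M, ?_⟩
  filter_upwards [hlim.eventually hM, eventually_planeParam_denom (1, 0),
    Metric.tendsto_nhds.1 hpar 1 one_pos, hx, hy] with g h1 h2 h3 h4 h5
  obtain ⟨a, b, hab⟩ := hf (tangentLine (1, 0) (planeParam (1, 0) g))
  have h6 := h1 a b hab
  have h7 := tangentLine_planeParam_t (p := (1, 0)) h2
  have h8 := hab.le (q := g) (by rw [h7]; ring)
  have h9 := h₀.le (tangentLine_t hp 0 (planeParam (1, 0) g))
  set s := planeParam (1, 0) g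
  rw [Real.dist_eq, sub_zero] at h3
  simp only [tangentLine] at h6 h8 h9 ⊢
  have h10 : |b₀ * s| ≤ |b₀| := by
    rw [abs_mul]; exact mul_le_of_le_one_right (abs_nonneg _) h3.le
  have h11 : |a * (g.1 - 1)| ≤ |a| * 2 := by
    rw [abs_mul]
    refine mul_le_mul_of_nonneg_left ?_ (abs_nonneg _)
    rw [abs_le]; constructor <;> linarith [abs_lt.1 h4]
  have h12 : |b * (g.2.1 - s)| ≤ |b| * 2 := by
    rw [abs_mul]
    refine mul_le_mul_of_nonneg_left ?_ (abs_nonneg _)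
    rw [abs_le]; constructor <;> linarith [abs_lt.1 h5, abs_lt.1 h3]
  have h13 := (abs_le.1 h10).1
  have h14 := (abs_le.1 h11).1
  have h15 := (abs_le.1 h12).1
  norm_num at h6 h8 h9 ⊢
  linarith

theorem eventually_zero_subgradient_le (hf : HSubdifferentiable f) :
    ∃ K, ∀ᶠ g in 𝓝 (0 : ℝ × ℝ × ℝ), ∀ a b, IsHSubgradient f g a b → |a| ≤ K ∧ |b| ≤ K := by
  obtain ⟨M, hM⟩ := hf.eventually_zero_upper
  obtain ⟨m, hm⟩ := hf.eventually_zero_lower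
  refine ⟨4 * (M - m), ?_⟩
  filter_upwards [hM, hm] with g h1 h2 a b hab
  have := h1 a b hab
  constructor <;> linarith [abs_nonneg a, abs_nonneg b]

/-- The increments of `f` along short horizontal segments near the origin are small. -/
theorem tendsto_sub (hf : HSubdifferentiable f) {ι : Type*} {l : Filter ι} {p q : ι → ℝ × ℝ × ℝ}
    (hp : Tendsto p l (𝓝 0)) (hq : Tendsto q l (𝓝 0))
    (hpq : ∀ i, (q i).2.2 = (p i).2.2 + 2 * ((q i).1 * (p i).2.1 - (p i).1 * (q i).2.1)) :
    Tendsto (fun i => f (p i) - f (q i)) l (𝓝 0) := by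
  obtain ⟨K, hK⟩ := hf.eventually_zero_subgradient_le
  have hlim : Tendsto (fun i => K * |(q i).1 - (p i).1| + K * |(q i).2.1 - (p i).2.1|) l
      (𝓝 0) := by
    have h1 := ((continuous_fst.tendsto _).comp hq).sub ((continuous_fst.tendsto _).comp hp)
    have h2 := (((continuous_fst.comp continuous_snd).tendsto _).comp hq).sub
      (((continuous_fst.comp continuous_snd).tendsto _).comp hp)
    simpa using (h1.abs.const_mul K).add (h2.abs.const_mul K)
  refine squeeze_zero_norm' ?_ hlim
  filter_upwards [hp.eventually hK, hq.eventually hK] with i h1 h2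
  obtain ⟨a, b, hab⟩ := hf (p i)
  obtain ⟨c, d, hcd⟩ := hf (q i)
  obtain ⟨ha, hb⟩ := h1 a b hab
  obtain ⟨hc, hd⟩ := h2 c d hcd
  have h3 := hab.le (hpq i)
  have h4 := hcd.le (q := p i) (by rw [hpq i]; ring)
  have hmul : ∀ {r e : ℝ}, |r| ≤ K → |r * e| ≤ K * |e| := fun hr => by
    rw [abs_mul]; exact mul_le_mul_of_nonneg_right hr (abs_nonneg _)
  have h5 := (abs_le.1 (hmul (e := (q i).1 - (p i).1) ha)).1
  have h6 := (abs_le.1 (hmul (e := (q i).2.1 - (p i).2.1) hb)).1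
  have h7 := (abs_le.1 (hmul (e := (q i).1 - (p i).1) hc)).2
  have h8 := (abs_le.1 (hmul (e := (q i).2.1 - (p i).2.1) hd)).2
  rw [Real.norm_eq_abs, abs_le]
  constructor <;> linarith

/-- Four short horizontal segments join `g` to the origin, via `(0, 0, t)`, `(√|t|, 0, t)` and `(0,
t / (2 * √|t|), 0)`. At `t = 0` the quotient is `0` by convention and the intermediate points are
the origin. -/
theorem continuousAt_zero (hf : HSubdifferentiable f) : ContinuousAt f 0 := by
  have ht : Tendsto (fun g : ℝ × ℝ × ℝ => g.2.2) (𝓝 0) (𝓝 0) :=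
    (continuous_snd.comp continuous_snd).tendsto (0 : ℝ × ℝ × ℝ)
  have hs : Tendsto (fun g : ℝ × ℝ × ℝ => √|g.2.2|) (𝓝 0) (𝓝 0) := by
    simpa using ht.abs.sqrt
  have hq : Tendsto (fun g : ℝ × ℝ × ℝ => g.2.2 / (2 * √|g.2.2|)) (𝓝 0) (𝓝 0) := by
    refine squeeze_zero_norm (fun g => ?_) hs
    rw [norm_div, norm_mul, Real.norm_of_nonneg (Real.sqrt_nonneg _), Real.norm_eq_abs]
    refine div_le_of_le_mul₀ (by positivity) (by positivity) ?_
    have := Real.mul_self_sqrt (abs_nonneg g.2.2)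
    norm_num
    nlinarith [abs_nonneg g.2.2]
  have h0 : Tendsto (fun _ : ℝ × ℝ × ℝ => (0 : ℝ)) (𝓝 0) (𝓝 0) := tendsto_const_nhds
  have htriple : ∀ {α β γ : ℝ × ℝ × ℝ → ℝ}, Tendsto α (𝓝 0) (𝓝 0) → Tendsto β (𝓝 0) (𝓝 0) →
      Tendsto γ (𝓝 0) (𝓝 0) → Tendsto (fun g => (α g, β g, γ g)) (𝓝 0) (𝓝 0) :=
    fun ha hb hc => ha.prodMk_nhds (hb.prodMk_nhds hc)
  have e1 := hf.tendsto_sub (tendsto_id (x := 𝓝 (0 : ℝ × ℝ × ℝ))) (htriple h0 h0 ht)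
    (fun g => by simp)
  have e2 := hf.tendsto_sub (htriple h0 h0 ht) (htriple hs h0 ht) (fun g => by simp)
  have e3 := hf.tendsto_sub (htriple hs h0 ht) (htriple h0 hq h0) (fun g => by
    rcases eq_or_ne g.2.2 0 with h | h
    · simp [h]
    · have : √|g.2.2| ≠ 0 := by positivity
      field_simp
      ring)
  have e4 := hf.tendsto_sub (htriple h0 hq h0) (htriple h0 h0 h0) (fun g => by simp)
  have := (((e1.add e2).add e3).add e4).add_const (f 0)
  simp only [add_zero, zero_add] at this
  refine this.congr fun g => ?_
  change _ + (f _ - f 0) + f 0 = f g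
  simp

/-- A function with a horizontal subgradient at every point is continuous. -/
theorem continuous (hf : HSubdifferentiable f) : Continuous f := by
  rw [continuous_iff_continuousAt]
  intro q
  have h := (hf.comp_leftTranslate q).continuousAt_zero
  rw [← leftTranslate_neg_self q] at h
  have := h.comp (continuous_leftTranslate (-q)).continuousAt
  simpa only [Function.comp_def, leftTranslate_neg] using this

end HSubdifferentiable

/-! ### Surjectivity for horizontal subdifferentials -/

theorem hSubdifferentiable_of_nonempty {u : Heisenberg → ℝ}
    (hu : ∀ g, (hSubdifferential u g).Nonempty) :
    HSubdifferentiable fun p => u ⟨p.1, p.2.1, p.2.2⟩ := by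
  intro p
  obtain ⟨v, hv⟩ := hu ⟨p.1, p.2.1, p.2.2⟩
  refine ⟨v 0, v 1, fun x y => ?_⟩
  have := hv ⟨x, y, p.2.2 + 2 * (x * p.2.1 - p.1 * y)⟩ (mem_horizontalPlane.2 rfl)
  refine le_trans (le_of_eq ?_) this
  simp [ξ₁, PiLp.inner_apply, Fin.sum_univ_two]
  ring

theorem mem_hSubdifferential_iff {u : Heisenberg → ℝ} {g : Heisenberg} {v : V₁} :
    v ∈ hSubdifferential u g ↔ ∀ w, u g + inner ℝ v w ≤ u (g * exp w) := by
  constructor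
  · intro h w
    simpa [ξ₁_mul_exp] using h _ (mul_exp_mem_horizontalPlane g w)
  · rintro h _ ⟨w, rfl⟩
    simpa [ξ₁_mul_exp] using h w

/-- If `u` is horizontally subdifferentiable everywhere, the restriction of `ξ₁ + lam ∂u` to any
horizontal plane is surjective. -/
theorem surjectiveOn_addSmul_hSubdifferential {u : Heisenberg → ℝ}
    (hu : ∀ g, (hSubdifferential u g).Nonempty) {lam : ℝ} (hlam : 0 < lam) (g : Heisenberg) :
    SurjectiveOn (addSmul lam (hSubdifferential u)) (horizontalPlane g) := by
  have hcont := (hSubdifferentiable_of_nonempty hu).continuous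
  have exp_zero : ∀ g, g * exp 0 = g := fun g => by simp [mul_exp]
  -- Two successive horizontal steps: `U w` explores the plane of `g * exp w`, and the step `-w`
  -- returns to `g`.
  have key := EuclideanSpace.exists_add_smul_subgradient
    (U := fun w p => u (g * exp w * exp p)) ?_ ?_ ?_ ?_ hlam
  · refine Set.eq_univ_of_forall fun z => ?_
    obtain ⟨w, v, hwv, hv⟩ := key (z - ξ₁ g)
    simp only [exp_zero] at hv
    refine Set.mem_biUnion (mul_exp_mem_horizontalPlane g w)
      ⟨v, mem_hSubdifferential_iff.2 hv, ?_⟩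
    simp only [ξ₁_mul_exp]
    rw [add_assoc, hwv, add_sub_cancel]
  · simp only [mul_exp]
    refine hcont.comp (f := fun q : V₁ × V₁ => ((_, _, _) : ℝ × ℝ × ℝ)) ?_
    fun_prop
  · intro w
    congr 1
    ext <;> simp [mul_exp]
    ring
  · intro w
    simp only [exp_zero]
  · intro w
    obtain ⟨v, hv⟩ := hu (g * exp w)
    simp only [exp_zero]
    exact ⟨v, mem_hSubdifferential_iff.1 hv⟩

end Heisenberg

theorem mainTheorem1 (T : Heisenberg → Set Heisenberg.V₁)
    (hT : Heisenberg.HMonotone T) (hdom : Heisenberg.dom T = Set.univ)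
    (lam : ℝ) (hlam : 0 < lam) :
    (Heisenberg.MaximalHCyclicallyMonotone T →
      ∀ g : Heisenberg,
        Heisenberg.SurjectiveOn (Heisenberg.addSmul lam T) (Heisenberg.horizontalPlane g)) ∧
    ((∀ g : Heisenberg,
        Heisenberg.SurjectiveOn (Heisenberg.addSmul lam T) (Heisenberg.horizontalPlane g)) →
      Heisenberg.MaximalHMonotone T) := by
  refine ⟨fun hmax => ?_, Heisenberg.maximalHMonotone_of_surjectiveOn hT hlam⟩
  obtain ⟨u, rfl⟩ := hmax.exists_eq_hSubdifferential hdom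
  refine Heisenberg.surjectiveOn_addSmul_hSubdifferential (fun g => ?_) hlam
  have : g ∈ Heisenberg.dom (Heisenberg.hSubdifferential u) := hdom ▸ Set.mem_univ g
  exact this
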